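/- Let $k$ be a field and let $X$ and $Y$ be $k$-schemes. Write $k[X]=\Gamma(X,\mathcal O_X)$. Assume that $X$ is quasi-compact and quasi-separated, that the ring $k[X]$ is reduced, and that $k$ is algebraically closed in $k[X]$ (every element of $k[X]$ that is algebraic over $k$ lies in the image of $k$). Call a field extension $K/k$ regular if $K$ is linearly disjoint over $k$ from an algebraic closure $\bar k$ of $k$, that is, if $\bar k\otimes_k K$ is a domain (equivalently, $K/k$ is separable and $k$ is algebraically closed in $K$). Assume one of the following: 1. $Y$ is integral, and its function field $\mathcal O_{Y,\eta}$ ($\eta$ the generic point of $Y$) is a regular extension of $k$; or 2. $Y$ is quasi-compact and quasi-separated, and $B=\Gamma(Y,\mathcal O_Y)$ is a domain whose field of fractions $Q(B)$ is a regular extension of $k$. Then for every unit $\alpha\in\Gamma(X\times_k Y,\mathcal O_{X\times_k Y})^\times$ there exist units $\mu\in\Gamma(X,\mathcal O_X)^\times$ and $\nu\in\Gamma(Y,\mathcal O_Y)^\times$ such that $\alpha(x,y)=\mu(x)\nu(y)$, i.e. $\alpha=p_1^*\mu\cdot p_2^*\nu$ in $\Gamma(X\times_k Y,\mathcal O_{X\times_k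 Y})$, where $p_1,p_2$ are the projections. -/

import Mathlib

open AlgebraicGeometry CategoryTheory
open scoped TensorProduct

universe u v

/-- The structure map `k → Γ(X, 𝒪_X)` of a `k`-scheme `f : X ⟶ Spec k`. -/
noncomputable def scalarsToSections {k : Type u} [Field k] {X : Scheme.{u}}
    (f : X ⟶ Spec (CommRingCat.of k)) : k →+* Γ(X, ⊤) :=
  ((Scheme.ΓSpecIso (CommRingCat.of k)).inv ≫ f.appTop).hom

/-- The structure map `k → 𝒪_{Y,η}` into the function field of an integral `k`-scheme. -/
noncomputable def scalarsToFunctionField {k : Type u} [Field k] {Y : Scheme.{u}}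
    [IsIntegral Y] (g : Y ⟶ Spec (CommRingCat.of k)) : k →+* Y.functionField :=
  (Y.presheaf.germ ⊤ (genericPoint Y) trivial).hom.comp (scalarsToSections g)

/-- `k` is algebraically closed in the `k`-algebra `A`: every element of `A` that is a root of
a nonzero polynomial over `k` comes from `k`. -/
def IsAlgebraicallyClosedIn {k : Type u} {A : Type v} [Field k] [CommRing A]
    (φ : k →+* A) : Prop :=
  ∀ a : A, (∃ p : Polynomial k, p ≠ 0 ∧ p.eval₂ φ a = 0) → a ∈ φ.range

/-- The field extension `φ : k → K` is regular: `K` is linearly disjoint over `k` from an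
algebraic closure `k̄` of `k`, i.e. `k̄ ⊗[k] K` is a domain. -/
def IsRegularExtension {k : Type u} {K : Type v} [Field k] [Field K] (φ : k →+* K) : Prop :=
  letI : Algebra k K := φ.toAlgebra
  IsDomain (AlgebraicClosure k ⊗[k] K)

/-! Put A = k[X]. The heart is algebraic: if K/k is regular, every unit of K ⊗ A is a pure tensor c
⊗ a (`exists_eq_tmul_of_isUnit`). Given this, a unit of B ⊗ A with B ⊆ K, divided by a, maps to c ⊗
1, and a k-linear functional on A shows c ∈ B.

Over an algebraically closed field this is Rosenlicht's argument (`exists_eq_tensorEval_tmul`). For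
a finitely generated domain D, scale a unit of K ⊗ D to have value 1 at a rational point. Its
coefficients then lie in every valuation ring of K over k, by a Gauss lemma resting on (residue
field) ⊗ D being a domain; hence they lie in k. If the spectrum is only connected, the argument runs
on each component and spreads across intersections, leaving a nilpotent error.

For general k pass to an algebraic closure L. As k is algebraically closed in A, L ⊗ A has only
trivial idempotents, but it may have nilpotents; a q^n-th power, q the characteristic exponent,
removes the error. So x^(q^n) is a pure tensor over Frac(L ⊗ K), and ratios of its coefficients lie
in K ∩ L = k. Regularity keeps q^n-th powers of a k-basis of K independent, and A is reduced, so x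
itself is pure (`exists_eq_tmul_of_pow_eq_tmul`).

Flat base change identifies sections over X × V with Γ(X) ⊗ Γ(V). This settles case 2; in case 1 the
factorisation over one affine open is propagated by gluing (`exists_eq_sndSections`). -/

/-! ### Rational points and tensor products over an algebraically closed field -/

theorem Module.Basis.baseChange_repr_map {k S S' B ι : Type*} [CommRing k] [CommRing S]
    [CommRing S'] [CommRing B] [Algebra k S] [Algebra k S'] [Algebra k B]
    (b : Module.Basis ι k B) (f : S →ₐ[k] S') (x : S ⊗[k] B) (i : ι) :
    (b.baseChange S').repr (Algebra.TensorProduct.map f (AlgHom.id k B) x) i =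
      f ((b.baseChange S).repr x i) := by
  induction x with
  | zero => simp
  | add x y hx hy => simp [hx, hy]
  | tmul s y => simp

/-- A non-nilpotent element of a finitely generated algebra over an algebraically closed field
does not vanish at some rational point. -/
theorem exists_algHom_apply_ne_zero {k A : Type*} [Field k] [IsAlgClosed k] [CommRing A]
    [Algebra k A] [Algebra.FiniteType k A] {a : A} (ha : ¬ IsNilpotent a) :
    ∃ φ : A →ₐ[k] k, φ a ≠ 0 := by
  have : IsJacobsonRing A := isJacobsonRing_of_finiteType (A := k)
  have h1 : a ∉ Ideal.jacobson (⊥ : Ideal A) := by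
    rwa [← Ideal.radical_eq_jacobson]
  simp only [Ideal.jacobson, Ideal.mem_sInf, not_forall] at h1
  obtain ⟨m, ⟨-, hm⟩, ham⟩ := h1
  let := Ideal.Quotient.field m
  have := finite_of_finite_type_of_isJacobsonRing k (A ⧸ m)
  let e := AlgEquiv.ofBijective (Algebra.ofId k (A ⧸ m))
    IsAlgClosed.algebraMap_bijective_of_isIntegral
  refine ⟨e.symm.toAlgHom.comp (Ideal.Quotient.mkₐ k m), ?_⟩
  simpa [Ideal.Quotient.eq_zero_iff_mem] using ham

/-- Evaluation of an element of `B ⊗ A` at a rational point of `A`. -/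
noncomputable def tensorEval {k A : Type*} (B : Type*) [CommRing k] [CommRing A] [CommRing B]
    [Algebra k A] [Algebra k B] (φ : A →ₐ[k] k) : B ⊗[k] A →ₐ[B] B :=
  Algebra.TensorProduct.lift (AlgHom.id B B) ((Algebra.ofId k B).comp φ) fun _ _ => Commute.all _ _

@[simp]
theorem tensorEval_tmul {k A B : Type*} [CommRing k] [CommRing A] [CommRing B]
    [Algebra k A] [Algebra k B] (φ : A →ₐ[k] k) (b : B) (a : A) :
    tensorEval B φ (b ⊗ₜ a) = b * algebraMap k B (φ a) := by
  simp [tensorEval, Algebra.ofId_apply]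

theorem tensorEval_map {k A B B' : Type*} [CommRing k] [CommRing A] [CommRing B] [CommRing B']
    [Algebra k A] [Algebra k B] [Algebra k B'] (φ : A →ₐ[k] k) (f : B →ₐ[k] B') (x : B ⊗[k] A) :
    tensorEval B' φ (Algebra.TensorProduct.map f (AlgHom.id k A) x) = f (tensorEval B φ x) := by
  induction x with
  | zero => simp
  | add x y hx hy => simp [hx, hy]
  | tmul s y => simp

/-- Over an algebraically closed field the tensor product of a domain with a finitely generated
domain is a domain. -/
theorem isDomain_tensorProduct_of_isAlgClosed {k A B : Type*} [Field k] [IsAlgClosed k]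
    [CommRing A] [CommRing B] [Algebra k A] [Algebra k B] [Algebra.FiniteType k A] [IsDomain A]
    [IsDomain B] : IsDomain (B ⊗[k] A) := by
  let b := Module.Basis.ofVectorSpace k B
  suffices NoZeroDivisors (A ⊗[k] B) by
    have : NoZeroDivisors (B ⊗[k] A) :=
      (Algebra.TensorProduct.comm k B A).injective.noZeroDivisors _ (map_zero _) (map_mul _)
    exact NoZeroDivisors.to_isDomain _
  refine ⟨fun {x y} hxy => ?_⟩
  by_contra! h
  obtain ⟨i, hi⟩ : ∃ i, (b.baseChange A).repr x i ≠ 0 := by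
    by_contra! h'
    exact h.1 ((b.baseChange A).repr.map_eq_zero_iff.1 (Finsupp.ext h'))
  obtain ⟨j, hj⟩ : ∃ i, (b.baseChange A).repr y i ≠ 0 := by
    by_contra! h'
    exact h.2 ((b.baseChange A).repr.map_eq_zero_iff.1 (Finsupp.ext h'))
  -- Specialise at a rational point of A where neither chosen coefficient vanishes; there the
  -- product lives in the domain k ⊗ B = B.
  obtain ⟨φ, hφ⟩ := exists_algHom_apply_ne_zero (k := k)
    (a := (b.baseChange A).repr x i * (b.baseChange A).repr y j)
    (by simpa [isNilpotent_iff_eq_zero] using ⟨hi, hj⟩)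
  rw [map_mul, ← b.baseChange_repr_map, ← b.baseChange_repr_map] at hφ
  have : NoZeroDivisors (k ⊗[k] B) :=
      (Algebra.TensorProduct.lid k B).injective.noZeroDivisors _ (map_zero _) (map_mul _)
  have h0 := congrArg (Algebra.TensorProduct.map φ (AlgHom.id k B)) hxy
  rw [map_mul, map_zero, mul_eq_zero] at h0
  rcases h0 with h0 | h0 <;> simp [h0] at hφ

/-! ### A Gauss lemma over valuation rings -/

section Valuation

variable {k D R K : Type*} [Field k] [CommRing D] [Algebra k D]
  [CommRing R] [IsDomain R] [ValuationRing R] [Field K] [Algebra k R] [Algebra k K] [Algebra R K]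
  [IsScalarTower k R K] [IsFractionRing R K]

/-- Extraction of content: dividing by a coefficient of maximal valuation makes all coefficients
integral and one of them equal to 1, which survives in the residue field. -/
theorem exists_smul_map_residue_ne_zero {x : K ⊗[k] D} (hx : x ≠ 0) :
    ∃ (c : K) (y : R ⊗[k] D), c ≠ 0 ∧
      x = c • Algebra.TensorProduct.map (IsScalarTower.toAlgHom k R K) (AlgHom.id k D) y ∧
      Algebra.TensorProduct.map (IsScalarTower.toAlgHom k R (IsLocalRing.ResidueField R))
        (AlgHom.id k D) y ≠ 0 := by
  classical
  let b := Module.Basis.ofVectorSpace k D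
  let v := ValuationRing.valuation R K
  set r := (b.baseChange K).repr x with hr
  have hr0 : r ≠ 0 := by simpa [hr] using hx
  obtain ⟨i, hi, hmax⟩ := r.support.exists_max_image (fun i => v (r i))
    (Finsupp.support_nonempty_iff.2 hr0)
  have hi0 : r i ≠ 0 := Finsupp.mem_support_iff.1 hi
  have h1 : ∀ j, ∃ s : R, algebraMap R K s = (r i)⁻¹ * r j := by
    intro j
    by_cases hj : r j = 0
    · exact ⟨0, by simp [hj]⟩
    rw [← ValuationRing.mem_integer_iff R K, Valuation.mem_integer_iff, map_mul, map_inv₀,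
      inv_mul_le_one₀ (zero_lt_iff.2 (by simpa using hi0))]
    exact hmax j (Finsupp.mem_support_iff.2 hj)
  choose s hs using h1
  have hsupp : ∀ j, s j ≠ 0 → j ∈ r.support := by
    intro j hj
    rw [Finsupp.mem_support_iff]
    intro h0
    have := hs j
    rw [h0, mul_zero, FaithfulSMul.algebraMap_eq_zero_iff] at this
    exact hj this
  let t : _ →₀ R := Finsupp.onFinset r.support s hsupp
  refine ⟨r i, (b.baseChange R).repr.symm t, hi0, ?_, ?_⟩
  · apply (b.baseChange K).repr.injective
    ext j
    rw [map_smul, Finsupp.smul_apply, b.baseChange_repr_map]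
    simp only [LinearEquiv.apply_symm_apply, IsScalarTower.coe_toAlgHom', t,
      Finsupp.onFinset_apply, hs, smul_eq_mul]
    rw [mul_inv_cancel_left₀ hi0]
  · intro h0
    have h2 := congrArg (fun z => (b.baseChange (IsLocalRing.ResidueField R)).repr z i) h0
    simp only [b.baseChange_repr_map] at h2
    have h3 : s i = 1 := by
      apply FaithfulSMul.algebraMap_injective R K
      rw [hs, inv_mul_cancel₀ hi0, map_one]
    simp [t, h3] at h2

variable [IsAlgClosed k] [Algebra.FiniteType k D] [IsDomain D]

/-- A unit of `K ⊗ D` is, up to a scalar in `K`, a unit of `R ⊗ D`. -/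
theorem exists_smul_map_isUnit {x : K ⊗[k] D} (hx : IsUnit x) :
    ∃ (c : K) (y : R ⊗[k] D), IsUnit y ∧
      x = c • Algebra.TensorProduct.map (IsScalarTower.toAlgHom k R K) (AlgHom.id k D) y := by
  let ι := Algebra.TensorProduct.map (IsScalarTower.toAlgHom k R K) (AlgHom.id k D)
  let ρ := Algebra.TensorProduct.map (IsScalarTower.toAlgHom k R (IsLocalRing.ResidueField R))
        (AlgHom.id k D)
  have hι : Function.Injective ι :=
    Module.Flat.rTensor_preserves_injective_linearMap
      (IsScalarTower.toAlgHom k R K).toLinearMap (FaithfulSMul.algebraMap_injective R K)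
  have : IsDomain (IsLocalRing.ResidueField R ⊗[k] D) := isDomain_tensorProduct_of_isAlgClosed
  have : IsDomain (K ⊗[k] D) := isDomain_tensorProduct_of_isAlgClosed
  obtain ⟨x', hxx'⟩ := hx.exists_right_inv
  obtain ⟨c, y, hc, rfl, hy⟩ := exists_smul_map_residue_ne_zero (R := R) hx.ne_zero
  obtain ⟨c', y', hc', rfl, hy'⟩ := exists_smul_map_residue_ne_zero (R := R)
    (right_ne_zero_of_mul_eq_one hxx')
  refine ⟨c, y, ?_, rfl⟩
  rw [smul_mul_smul_comm, ← map_mul] at hxx'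
  have key : ∀ r : R, ι (algebraMap R _ r) = algebraMap K _ (algebraMap R K r) := by
    intro r
    simp [ι, Algebra.TensorProduct.algebraMap_apply]
  have key' : ∀ r : R, ρ (algebraMap R _ r) = algebraMap _ _ (IsLocalRing.residue R r) := by
    intro r
    simp [ρ, Algebra.TensorProduct.algebraMap_apply]
  have hunit : ∀ r : R, ρ (algebraMap R _ r) ≠ 0 → IsUnit (algebraMap R (R ⊗[k] D) r) := by
    intro r hr
    refine IsUnit.map _ ?_
    rw [key'] at hr
    rw [← IsLocalRing.residue_ne_zero_iff_isUnit]
    rintro h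
    simp [h] at hr
  -- Here c c' · y y' = 1. If c c' is integral, y y' is visibly invertible. Otherwise y y' is a
  -- scalar r of R whose residue is a product of nonzero elements of a domain, so r is a unit.
  rcases ValuationRing.isInteger_or_isInteger R (c * c') with ⟨r, hr⟩ | ⟨r, hr⟩
  · have h1 : algebraMap R _ r * (y * y') = 1 := by
      apply hι
      rw [map_mul, key, map_one, hr, ← hxx', Algebra.smul_def]
    exact isUnit_of_mul_isUnit_left (isUnit_of_mul_isUnit_right (h1 ▸ isUnit_one))
  · have h1 : y * y' = algebraMap R _ r := by
      apply hι
      rw [key, hr, Algebra.algebraMap_eq_smul_one, ← hxx', inv_smul_smul₀ (mul_ne_zero hc hc')]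
    exact isUnit_of_mul_isUnit_left (h1 ▸ hunit r (by rw [← h1, map_mul]; exact mul_ne_zero hy hy'))

/-- Write x = c • y with y a unit over R. The value of y at the point is a unit of R, so normalising
x to have value 1 forces c into R. -/
theorem repr_mem_range_of_tensorEval_eq_one {x : K ⊗[k] D} (hx : IsUnit x) (φ : D →ₐ[k] k)
    (hφ : tensorEval K φ x = 1) {ι : Type*} (b : Module.Basis ι k D) (i : ι) :
    (b.baseChange K).repr x i ∈ (algebraMap R K).range := by
  obtain ⟨c, y, hy, rfl⟩ := exists_smul_map_isUnit (R := R) hx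
  rw [map_smul, tensorEval_map] at hφ
  obtain ⟨s, hs⟩ := (hy.map (tensorEval R φ)).exists_right_inv
  have hc : c = algebraMap R K s := by
    have := congrArg (algebraMap R K) hs
    rw [map_mul, map_one] at this
    simp only [IsScalarTower.coe_toAlgHom', smul_eq_mul] at hφ
    calc c = c * (algebraMap R K (tensorEval R φ y) * algebraMap R K s) := by rw [this, mul_one]
      _ = _ := by rw [← mul_assoc, hφ, one_mul]
  rw [map_smul, Finsupp.smul_apply, b.baseChange_repr_map, hc]
  exact ⟨s * (b.baseChange R).repr y i, by simp⟩

end Valuation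

/-! ### Rosenlicht's theorem for domains -/

/-- The intersection of the valuation rings of K containing k is the integral closure of k, which is
k itself. -/
theorem mem_range_algebraMap_of_forall_valuationSubring {k K : Type*} [Field k] [IsAlgClosed k]
    [Field K] [Algebra k K] {x : K}
    (h : ∀ V : ValuationSubring K, Set.range (algebraMap k K) ⊆ V → x ∈ V) :
    x ∈ (algebraMap k K).range := by
  have h1 : x ∈ (⨅ V : {V : ValuationSubring K // Set.range (algebraMap k K) ⊆ V.toSubring},
      V.1.toSubring) := by
    rw [Subring.mem_iInf]
    exact fun V => h V.1 V.2
  rw [iInf_valuationSubring_superset] at h1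
  let f : k →+* Subring.closure (Set.range (algebraMap k K)) :=
    (algebraMap k K).codRestrict _ fun y => Subring.subset_closure ⟨y, rfl⟩
  let : Algebra k (Subring.closure (Set.range (algebraMap k K))) := f.toAlgebra
  have : IsScalarTower k (Subring.closure (Set.range (algebraMap k K))) K :=
    IsScalarTower.of_algebraMap_eq fun _ => rfl
  have : Algebra.IsIntegral k (Subring.closure (Set.range (algebraMap k K))) := by
    refine ⟨fun s => ?_⟩
    obtain ⟨y, hy⟩ := Subring.closure_le.2 (RingHom.coe_range (algebraMap k K)).ge s.2
    exact (Subtype.ext hy : algebraMap k _ y = s) ▸ isIntegral_algebraMap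
  have hint : IsIntegral k x :=
    isIntegral_trans (A := Subring.closure (Set.range (algebraMap k K))) x h1
  obtain ⟨y, hy⟩ := (IsAlgClosed.algebraMap_bijective_of_isIntegral (k := k)
    (K := integralClosure k K)).2 ⟨x, hint⟩
  exact ⟨y, congrArg Subtype.val hy⟩

/-- Rosenlicht: over an algebraically closed field `k`, a unit of `K ⊗ D`, with `K` a field and `D`
a finitely generated domain, is a pure tensor. -/
theorem exists_eq_tensorEval_tmul {k D K : Type*} [Field k] [IsAlgClosed k] [CommRing D]
    [Algebra k D] [Algebra.FiniteType k D] [IsDomain D] [Field K] [Algebra k K]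
    {x : K ⊗[k] D} (hx : IsUnit x) (φ : D →ₐ[k] k) :
    ∃ d : D, x = tensorEval K φ x ⊗ₜ d := by
  let b := Module.Basis.ofVectorSpace k D
  set c := tensorEval K φ x with hc
  have hc0 : c ≠ 0 := (hx.map (tensorEval K φ)).ne_zero
  have hx' : IsUnit (c⁻¹ • x) := by
    rw [Algebra.smul_def]
    exact ((IsUnit.mk0 _ (inv_ne_zero hc0)).map _).mul hx
  have hφ : tensorEval K φ (c⁻¹ • x) = 1 := by
    rw [map_smul, ← hc, smul_eq_mul, inv_mul_cancel₀ hc0]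
  have hmem : ∀ i, (b.baseChange K).repr (c⁻¹ • x) i ∈ (algebraMap k K).range := by
    intro i
    apply mem_range_algebraMap_of_forall_valuationSubring
    intro V hV
    let f : k →+* V := (algebraMap k K).codRestrict V fun y => hV ⟨y, rfl⟩
    let : Algebra k V := f.toAlgebra
    have : IsScalarTower k V K := IsScalarTower.of_algebraMap_eq fun _ => rfl
    obtain ⟨v, hv⟩ := repr_mem_range_of_tensorEval_eq_one (R := V) hx' φ hφ b i
    rw [← hv]
    exact v.2
  choose l hl using hmem
  have h1 : c⁻¹ • x = 1 ⊗ₜ (∑ i ∈ ((b.baseChange K).repr (c⁻¹ • x)).support, l i • b i) := by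
    conv_lhs => rw [← (b.baseChange K).linearCombination_repr (c⁻¹ • x)]
    rw [Finsupp.linearCombination_apply, Finsupp.sum, TensorProduct.tmul_sum]
    refine Finset.sum_congr rfl fun i _ => ?_
    rw [← hl, Module.Basis.baseChange_apply, TensorProduct.tmul_smul, algebraMap_smul]
  rw [inv_smul_eq_iff₀ hc0] at h1
  exact ⟨_, h1.trans (by rw [TensorProduct.smul_tmul', smul_eq_mul, mul_one])⟩

/-! ### Connected algebras, modulo nilpotents -/

theorem exists_linearMap_apply_one (k K : Type*) [Field k] [CommRing K] [Nontrivial K]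
    [Algebra k K] : ∃ l : K →ₗ[k] k, l 1 = 1 :=
  (Algebra.linearMap k K).exists_leftInverse_of_injective
      (LinearMap.ker_eq_bot.2 (algebraMap k K).injective) |>.imp fun l hl => by
    simpa using LinearMap.congr_fun hl 1

/-- With respect to a k-basis of K, the coefficients of z lie in every prime of A. -/
theorem mem_map_nilradical_of_forall_prime {k A K : Type*} [Field k] [CommRing A] [Algebra k A]
    [Field K] [Algebra k K] {z : K ⊗[k] A}
    (hz : ∀ P : Ideal A, P.IsPrime →
      Algebra.TensorProduct.map (AlgHom.id k K) (Ideal.Quotient.mkₐ k P) z = 0) :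
    z ∈ (nilradical A).map (Algebra.TensorProduct.includeRight : A →ₐ[k] K ⊗[k] A) := by
  let b := Module.Basis.ofVectorSpace k K
  set w := Algebra.TensorProduct.comm k K A z with hw
  have hmem : ∀ i, (b.baseChange A).repr w i ∈ nilradical A := by
    intro i
    rw [mem_nilradical, nilpotent_iff_mem_prime]
    intro P hP
    rw [← Ideal.Quotient.eq_zero_iff_mem, ← Ideal.Quotient.mkₐ_eq_mk k,
      ← b.baseChange_repr_map]
    have : Algebra.TensorProduct.map (Ideal.Quotient.mkₐ k P) (AlgHom.id k K) w =
        Algebra.TensorProduct.comm k K (A ⧸ P)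
          (Algebra.TensorProduct.map (AlgHom.id k K) (Ideal.Quotient.mkₐ k P) z) := by
      rw [hw]
      generalize z = z
      induction z with
      | zero => simp
      | add x y hx hy => simp [hx, hy]
      | tmul s y => simp
    rw [this, hz P hP]
    simp
  have hz' : z = (Algebra.TensorProduct.comm k K A).symm w := by simp [hw]
  rw [hz', ← (b.baseChange A).linearCombination_repr w, Finsupp.linearCombination_apply,
    Finsupp.sum, map_sum]
  refine Ideal.sum_mem _ fun i _ => ?_
  have : (Algebra.TensorProduct.comm k K A).symm
      ((b.baseChange A).repr w i • (b.baseChange A) i) =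
      (b i ⊗ₜ 1) * Algebra.TensorProduct.includeRight ((b.baseChange A).repr w i) := by
    rw [Module.Basis.baseChange_apply, TensorProduct.smul_tmul']
    simp
  rw [this]
  exact Ideal.mul_mem_left _ _ (Ideal.mem_map_of_mem _ (hmem i))

/-- Let `k` be algebraically closed and `A` a finitely generated `k`-algebra with connected
spectrum. A unit of `K ⊗ A`, with `K` a field, is a pure tensor up to nilpotents of `A`. -/
theorem exists_sub_tmul_mem_map_nilradical {k A K : Type*} [Field k] [IsAlgClosed k] [CommRing A]
    [Algebra k A] [Algebra.FiniteType k A] [Nontrivial A] [Field K] [Algebra k K]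
    (hA : ∀ e : A, IsIdempotentElem e → e = 0 ∨ e = 1) {x : K ⊗[k] A} (hx : IsUnit x) :
    ∃ (c : K) (a : A), x - c ⊗ₜ a ∈
      (nilradical A).map (Algebra.TensorProduct.includeRight : A →ₐ[k] K ⊗[k] A) := by
  obtain ⟨φ₀, -⟩ := exists_algHom_apply_ne_zero (k := k) (a := (1 : A)) not_isNilpotent_one
  set c := tensorEval K φ₀ x with hc
  have hc0 : c ≠ 0 := (hx.map (tensorEval K φ₀)).ne_zero
  set y := c⁻¹ • x with hy
  have hyu : IsUnit y := by
    rw [hy, Algebra.smul_def]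
    exact ((IsUnit.mk0 _ (inv_ne_zero hc0)).map _).mul hx
  have hφ₀ : tensorEval K φ₀ y = 1 := by
    rw [hy, map_smul, ← hc, smul_eq_mul, inv_mul_cancel₀ hc0]
  let π (P : Ideal A) := Algebra.TensorProduct.map (AlgHom.id k K) (Ideal.Quotient.mkₐ k P)
  -- `Good P` says that the normalised unit restricted to V(P) involves no element of K outside k.
  -- By Rosenlicht this can be tested at any one rational point of V(P).
  let Good (P : Ideal A) : Prop := ∃ d : A ⧸ P, π P y = 1 ⊗ₜ d
  have heval : ∀ (P : Ideal A) (φ : A →ₐ[k] k) (h : ∀ a ∈ P, φ a = 0) (z : K ⊗[k] A),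
      tensorEval K (Ideal.Quotient.liftₐ P φ h) (π P z) = tensorEval K φ z := by
    intro P φ h z
    induction z with
    | zero => simp
    | add x y hx hy => simp [hx, hy]
    | tmul s y =>
      simp only [π, Algebra.TensorProduct.map_tmul, tensorEval_tmul]
      rfl
  have hgood : ∀ (P : Ideal A) (φ : A →ₐ[k] k), P.IsPrime → (∀ a ∈ P, φ a = 0) →
      (Good P ↔ tensorEval K φ y ∈ (algebraMap k K).range) := by
    intro P φ hP h
    rw [← heval P φ h]
    constructor
    · rintro ⟨d, hd⟩
      rw [hd]
      exact ⟨_, by rw [tensorEval_tmul, one_mul]⟩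
    · rintro ⟨l, hl⟩
      obtain ⟨d, hd⟩ := exists_eq_tensorEval_tmul (hyu.map (π P)) (Ideal.Quotient.liftₐ P φ h)
      refine ⟨l • d, hd.trans ?_⟩
      rw [← hl, TensorProduct.tmul_smul, TensorProduct.smul_tmul', Algebra.algebraMap_eq_smul_one]
  have hpt : ∀ Q : Ideal A, Q.IsPrime → ∃ φ : A →ₐ[k] k, ∀ a ∈ Q, φ a = 0 := by
    intro Q hQ
    obtain ⟨ψ, -⟩ := exists_algHom_apply_ne_zero (k := k) (a := (1 : A ⧸ Q)) not_isNilpotent_one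
    refine ⟨ψ.comp (Ideal.Quotient.mkₐ k Q), fun a ha => ?_⟩
    simp [Ideal.Quotient.eq_zero_iff_mem.2 ha]
  have : IsNoetherianRing A := Algebra.FiniteType.isNoetherianRing k A
  let Z (p : Ideal A → Prop) : Set (PrimeSpectrum A) :=
    ⋃ P ∈ {P ∈ minimalPrimes A | p P}, PrimeSpectrum.zeroLocus P
  have hZc : ∀ p, IsClosed (Z p) := fun p =>
    ((minimalPrimes.finite_of_isNoetherianRing A).subset (Set.sep_subset _ _)).isClosed_biUnion
      fun P _ => PrimeSpectrum.isClosed_zeroLocus _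
  have hmem : ∀ p (Q : PrimeSpectrum A), Q ∈ Z p ↔
      ∃ P ∈ minimalPrimes A, p P ∧ P ≤ Q.asIdeal := by
    intro p Q
    simp [Z, PrimeSpectrum.mem_zeroLocus, and_assoc]
  -- Two components that meet share a rational point, hence are both good or both bad; so the good
  -- ones fill a clopen set.
  have hcompl : (Z Good)ᶜ = Z fun P => ¬ Good P := by
    ext Q
    rw [Set.mem_compl_iff, hmem, hmem]
    constructor
    · intro h
      obtain ⟨P, hP, hPQ⟩ := Ideal.exists_minimalPrimes_le (bot_le : ⊥ ≤ Q.asIdeal)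
      exact ⟨P, hP, fun hg => h ⟨P, hP, hg, hPQ⟩, hPQ⟩
    · rintro ⟨P, hP, hb, hPQ⟩ ⟨P', hP', hg, hPQ'⟩
      obtain ⟨φ, hφ⟩ := hpt Q.asIdeal Q.2
      exact hb ((hgood P φ hP.1.1 fun a ha => hφ a (hPQ ha)).2
        ((hgood P' φ hP'.1.1 fun a ha => hφ a (hPQ' ha)).1 hg))
  have hclopen : IsClopen (Z Good) :=
    ⟨hZc _, isClosed_compl_iff.1 (hcompl ▸ hZc _)⟩
  have hall : ∀ Q, Q ∈ Z Good := by
    obtain ⟨e, he, heZ⟩ := PrimeSpectrum.exists_idempotent_basicOpen_eq_of_isClopen hclopen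
    rcases hA e he with rfl | rfl
    · exfalso
      have hker : (RingHom.ker φ₀).IsPrime := RingHom.ker_isPrime φ₀
      obtain ⟨P, hP, hPQ⟩ := Ideal.exists_minimalPrimes_le (bot_le : ⊥ ≤ RingHom.ker φ₀)
      have : (⟨_, hker⟩ : PrimeSpectrum A) ∈ Z Good := by
        rw [hmem]
        refine ⟨P, hP, (hgood P φ₀ hP.1.1 fun a ha => hPQ ha).2 ?_, hPQ⟩
        rw [hφ₀]
        exact one_mem _
      simp [heZ] at this
    · intro Q
      simp [heZ]
  have hallgood : ∀ Q : Ideal A, Q.IsPrime → Good Q := by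
    intro Q hQ
    obtain ⟨P, hP, hg, hPQ⟩ := (hmem _ _).1 (hall ⟨Q, hQ⟩)
    obtain ⟨φ, hφ⟩ := hpt Q hQ
    exact (hgood Q φ hQ hφ).2 ((hgood P φ hP.1.1 fun a ha => hφ a (hPQ ha)).1 hg)
  -- A functional on K with l(1) = 1 turns y into one global candidate in A, which agrees with d on
  -- every A/P.
  obtain ⟨l, hl⟩ := exists_linearMap_apply_one k K
  let pr (B : Type _) [CommRing B] [Algebra k B] : K ⊗[k] B →ₗ[k] B :=
    (TensorProduct.lid k B).toLinearMap ∘ₗ l.rTensor B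
  have hpr : ∀ (P : Ideal A) (z : K ⊗[k] A),
      pr (A ⧸ P) (π P z) = Ideal.Quotient.mkₐ k P (pr A z) := by
    intro P z
    induction z with
    | zero => simp
    | add x y hx hy => simp only [map_add, hx, hy]
    | tmul s y => simp [π, pr]
  have hfin : y - 1 ⊗ₜ pr A y ∈
      (nilradical A).map (Algebra.TensorProduct.includeRight : A →ₐ[k] K ⊗[k] A) := by
    refine mem_map_nilradical_of_forall_prime fun P hP => ?_
    obtain ⟨d, hd⟩ := hallgood P hP
    have h1 := hpr P y
    change π P _ = 0
    rw [hd] at h1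
    rw [map_sub, hd, sub_eq_zero]
    simp only [π, Algebra.TensorProduct.map_tmul, map_one, ← h1]
    simp [pr, hl]
  refine ⟨c, pr A y, ?_⟩
  have : x - c ⊗ₜ pr A y = algebraMap K _ c * (y - 1 ⊗ₜ pr A y) := by
    rw [← Algebra.smul_def, smul_sub, hy, smul_inv_smul₀ hc0, TensorProduct.smul_tmul',
      smul_eq_mul, mul_one]
  rw [this]
  exact Ideal.mul_mem_left _ _ hfin

/-! ### Integral elements after algebraic base change -/

section Integral

variable {k A : Type*} [Field k] [CommRing A] [Algebra k A]
-- A finite separable extension is étale, and integral closure commutes with smooth base change.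
theorem mem_range_algebraMap_of_isIntegral_of_isSeparable
    (hA : ∀ a : A, IsIntegral k a → a ∈ (algebraMap k A).range) {F : Type*} [Field F]
    [Algebra k F] [FiniteDimensional k F] [Algebra.IsSeparable k F] {x : F ⊗[k] A} (hx : IsIntegral F x) :
    x ∈ (algebraMap F (F ⊗[k] A)).range := by
  have : Algebra.FormallyEtale k F := .of_isSeparable k F
  have : Algebra.FinitePresentation k F := Algebra.FinitePresentation.of_finiteType.1 inferInstance
  have : Algebra.Smooth k F := { }
  obtain ⟨t, ht⟩ := (TensorProduct.toIntegralClosure_bijective_of_smooth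
    (R := k) (S := F) (B := A)).2 ⟨x, hx⟩
  have hx' : ((TensorProduct.toIntegralClosure k F A t : integralClosure F (F ⊗[k] A)) :
      F ⊗[k] A) = x := by rw [ht]
  rw [← hx']
  clear hx' ht
  induction t with
  | zero => simp
  | add x y hx hy => simpa using add_mem hx hy
  | tmul s b =>
    obtain ⟨c, hc⟩ := hA b b.2
    refine ⟨c • s, ?_⟩
    simp [TensorProduct.toIntegralClosure, Algebra.TensorProduct.algebraMap_apply, ← hc,
      Algebra.algebraMap_eq_smul_one (A := A), TensorProduct.smul_tmul']

variable {L : Type*} [Field L] [Algebra k L] [Algebra.IsAlgebraic k L] [Nontrivial A]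
  (q : ℕ) [ExpChar k q]

/-- L is purely inseparable over the separable closure of k, and q^n-th powers are additive, so it
suffices to treat pure tensors. -/
theorem exists_pow_mem_range_map_separable (x : L ⊗[k] A) :
    ∃ (n : ℕ) (F : IntermediateField k L), FiniteDimensional k F ∧ Algebra.IsSeparable k F ∧
      x ^ q ^ n ∈ (Algebra.TensorProduct.map F.val (AlgHom.id k A)).range := by
  have : ExpChar (L ⊗[k] A) q :=
    expChar_of_injective_algebraMap (algebraMap k (L ⊗[k] A)).injective q
  have mono : ∀ {F F' : IntermediateField k L}, F ≤ F' → ∀ {z : L ⊗[k] A},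
      z ∈ (Algebra.TensorProduct.map F.val (AlgHom.id k A)).range →
      z ∈ (Algebra.TensorProduct.map F'.val (AlgHom.id k A)).range := by
    rintro F F' h _ ⟨z, rfl⟩
    refine ⟨Algebra.TensorProduct.map (IntermediateField.inclusion h) (AlgHom.id k A) z, ?_⟩
    induction z with
    | zero => simp
    | add x y hx hy => simp only [map_add, hx, hy]
    | tmul s y => simp
  induction x with
  | zero => exact ⟨0, ⊥, inferInstance, inferInstance, by simp⟩
  | add x y hx hy =>
    obtain ⟨n, F, hF, hF', hx⟩ := hx
    obtain ⟨m, G, hG, hG', hy⟩ := hy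
    refine ⟨n + m, F ⊔ G, inferInstance, inferInstance, ?_⟩
    rw [add_pow_expChar_pow]
    refine add_mem (mono le_sup_left ?_) (mono le_sup_right ?_)
    · rw [pow_add, pow_mul]
      exact pow_mem hx _
    · rw [add_comm, pow_add, pow_mul]
      exact pow_mem hy _
  | tmul l a =>
    have : ExpChar (separableClosure k L) q := expChar_of_injective_algebraMap
      (algebraMap k (separableClosure k L)).injective q
    obtain ⟨n, s, hs⟩ := IsPurelyInseparable.pow_mem (separableClosure k L) q l
    have hsep : IsSeparable k (l ^ q ^ n) := mem_separableClosure_iff.1 (hs ▸ s.2)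
    refine ⟨n, IntermediateField.adjoin k {l ^ q ^ n}, ?_, ?_, ?_⟩
    · exact IntermediateField.adjoin.finiteDimensional hsep.isIntegral
    · rw [IntermediateField.isSeparable_adjoin_iff_isSeparable]
      simpa using hsep
    · exact ⟨⟨_, IntermediateField.mem_adjoin_simple_self k _⟩ ⊗ₜ (a ^ q ^ n), by simp⟩

/-- If `k` is integrally closed in `A`, then `L` is integrally closed in `L ⊗ A` up to
`p`-th powers. -/
theorem exists_pow_eq_algebraMap_of_isIntegral
    (hA : ∀ a : A, IsIntegral k a → a ∈ (algebraMap k A).range)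
    {x : L ⊗[k] A} (hx : IsIntegral L x) :
    ∃ (n : ℕ) (l : L), x ^ q ^ n = algebraMap L (L ⊗[k] A) l := by
  obtain ⟨n, F, _, _, y, hy⟩ := exists_pow_mem_range_map_separable q x
  have hinj : Function.Injective (Algebra.TensorProduct.map F.val (AlgHom.id k A)) :=
    Module.Flat.rTensor_preserves_injective_linearMap F.val.toLinearMap F.val.injective
  have h1 : IsIntegral k y := by
    rw [← isIntegral_algHom_iff _ hinj]
    have : IsIntegral k (x ^ q ^ n) := isIntegral_trans (A := L) _ (hx.pow _)
    rwa [← hy] at this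
  obtain ⟨s, rfl⟩ := mem_range_algebraMap_of_isIntegral_of_isSeparable hA (h1.tower_top (A := F))
  exact ⟨n, s, hy.symm.trans (by simp [Algebra.TensorProduct.algebraMap_apply])⟩

/-- A nilpotent is integral over L, so some q^n-th power is a nilpotent scalar. The content is in q
= 1, where this says that L ⊗ A is reduced. -/
theorem exists_pow_eq_zero_of_isNilpotent
    (hA : ∀ a : A, IsIntegral k a → a ∈ (algebraMap k A).range)
    {x : L ⊗[k] A} (hx : IsNilpotent x) :
    ∃ n : ℕ, x ^ q ^ n = 0 := by
  obtain ⟨m, hm⟩ := hx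
  have hint : IsIntegral L x := ⟨Polynomial.X ^ m, Polynomial.monic_X_pow m, by simp [hm]⟩
  obtain ⟨n, l, hl⟩ := exists_pow_eq_algebraMap_of_isIntegral q hA hint
  have : algebraMap L (L ⊗[k] A) (l ^ m) = 0 := by
    rw [map_pow, ← hl, ← pow_mul, mul_comm, pow_mul, hm, zero_pow]
    exact pow_ne_zero _ (expChar_pos k q).ne'
  rw [FaithfulSMul.algebraMap_eq_zero_iff] at this
  exact ⟨n, by rw [hl, eq_zero_of_pow_eq_zero this, map_zero]⟩

/-- An idempotent is a root of X² − X and equals its own q^n-th power, so it is an idempotent scalar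
of L. -/
theorem eq_zero_or_eq_one_of_isIdempotentElem
    (hA : ∀ a : A, IsIntegral k a → a ∈ (algebraMap k A).range)
    {e : L ⊗[k] A} (he : IsIdempotentElem e) :
    e = 0 ∨ e = 1 := by
  obtain ⟨q, hq⟩ := ExpChar.exists k
  have hint : IsIntegral L e := by
    refine ⟨Polynomial.X ^ 2 - Polynomial.X, ?_, by simp [pow_two, he.eq]⟩
    exact Polynomial.monic_X_pow_sub (by simp)
  obtain ⟨n, l, hl⟩ := exists_pow_eq_algebraMap_of_isIntegral q hA hint
  rw [he.pow_eq (pow_ne_zero _ (expChar_pos k q).ne')] at hl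
  have : IsIdempotentElem l := by
    apply FaithfulSMul.algebraMap_injective L (L ⊗[k] A)
    rw [map_mul, ← hl, he.eq]
  rcases IsIdempotentElem.iff_eq_zero_or_one.1 this with rfl | rfl
  · exact Or.inl (hl.trans (map_zero _))
  · exact Or.inr (hl.trans (map_one _))

end Integral

/-! ### Extracting q^n-th roots of pure tensors -/

theorem isUnit_right_of_isUnit_tmul {k K A : Type*} [Field k] [Field K] [Algebra k K] [CommRing A]
    [Algebra k A] {c : K} {a : A} (h : IsUnit (c ⊗ₜ[k] a)) : IsUnit a := by
  obtain ⟨l, hl⟩ := exists_linearMap_apply_one k K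
  let pr : K ⊗[k] A →ₗ[k] A := (TensorProduct.lid k A).toLinearMap ∘ₗ l.rTensor A
  have hpr : ∀ z, pr ((1 ⊗ₜ a) * z) = a * pr z := by
    intro z
    induction z with
    | zero => simp
    | add x y hx hy => simp only [mul_add, map_add, hx, hy]
    | tmul s y => simp [pr]
  have h1 : IsUnit ((1 : K) ⊗ₜ[k] a) := by
    have : c ⊗ₜ[k] a = c ⊗ₜ 1 * 1 ⊗ₜ a := by simp
    rw [this] at h
    exact isUnit_of_mul_isUnit_right h
  obtain ⟨z, hz⟩ := h1.exists_right_inv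
  refine IsUnit.of_mul_eq_one (pr z) ?_
  rw [← hpr, hz, Algebra.TensorProduct.one_def]
  simp [pr, hl]

/-- An element of `K ⊗ A` some `p`-power of which is a pure tensor is a pure tensor. -/
theorem exists_eq_tmul_of_pow_eq_tmul {k K A : Type*} [Field k] [Field K] [Algebra k K]
    [CommRing A] [IsReduced A] [Algebra k A]
    (hA : ∀ a : A, IsIntegral k a → a ∈ (algebraMap k A).range) (q n : ℕ) [ExpChar k q]
    {ι : Type*} (β : Module.Basis ι k K) (hβ : LinearIndependent k fun i => β i ^ q ^ n)
    {x : K ⊗[k] A} {c : K} {a : A} (ha : IsUnit a) (hx : x ^ q ^ n = c ⊗ₜ a) (hx0 : x ≠ 0) :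
    ∃ (c' : K) (a' : A), x = c' ⊗ₜ a' := by
  have hQ : q ^ n ≠ 0 := pow_ne_zero _ (expChar_pos k q).ne'
  set y := Algebra.TensorProduct.comm k K A x with hy
  set r := (β.baseChange A).repr y with hr
  have : Nontrivial (A ⊗[k] K) := ⟨y, 0, by simpa [hy] using hx0⟩
  have : ExpChar (A ⊗[k] K) q :=
    expChar_of_injective_algebraMap (algebraMap k (A ⊗[k] K)).injective q
  have hsum : y = ∑ i ∈ r.support, r i ⊗ₜ β i := by
    conv_lhs => rw [← (β.baseChange A).linearCombination_repr y]
    rw [Finsupp.linearCombination_apply, Finsupp.sum]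
    refine Finset.sum_congr rfl fun i _ => ?_
    rw [Module.Basis.baseChange_apply, TensorProduct.smul_tmul', smul_eq_mul, mul_one]
  have hpow : ∑ i ∈ r.support, (r i ^ q ^ n) ⊗ₜ[k] (β i ^ q ^ n) = a ⊗ₜ c := by
    have : y ^ q ^ n = a ⊗ₜ c := by rw [hy, ← map_pow, hx]; simp
    rw [← this, hsum, sum_pow_char_pow q]
    simp
  obtain ⟨m, hm⟩ := (Finsupp.linearCombination k fun i => β i ^ q ^ n).exists_leftInverse_of_injective
    (LinearMap.ker_eq_bot.2 hβ)
  have hm' : ∀ i, m (β i ^ q ^ n) = Finsupp.single i 1 := fun i => by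
    simpa using LinearMap.congr_fun hm (Finsupp.single i 1)
  -- Independence of the β i ^ q ^ n allows coefficients to be compared.
  have hrpow : ∀ i, r i ^ q ^ n = m c i • a := by
    classical
    intro i
    have h1 := congrArg ((TensorProduct.rid k A).toLinearMap ∘ₗ
      (Finsupp.lapply i ∘ₗ m).lTensor A) hpow
    rw [map_sum] at h1
    simp only [LinearMap.comp_apply, LinearMap.lTensor_tmul, hm', LinearEquiv.coe_coe,
      TensorProduct.rid_tmul, Finsupp.lapply_apply, Finsupp.single_apply, ite_smul, one_smul,
      zero_smul] at h1
    rw [← h1, Finset.sum_ite_eq']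
    split_ifs with h
    · rfl
    · rw [Finsupp.notMem_support_iff.1 h, zero_pow hQ]
  obtain ⟨i, hi⟩ : ∃ i, r i ≠ 0 := by
    by_contra! h
    have : y = 0 := (β.baseChange A).repr.map_eq_zero_iff.1 (Finsupp.ext h)
    exact hx0 (by simpa [hy] using this)
  have hmi : m c i ≠ 0 := by
    intro h
    have := hrpow i
    rw [h, zero_smul] at this
    exact hi (eq_zero_of_pow_eq_zero this)
  obtain ⟨u, hu⟩ : IsUnit (r i) := by
    rw [← isUnit_pow_iff hQ, hrpow, Algebra.smul_def]
    exact ((IsUnit.mk0 _ hmi).map _).mul ha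
  -- The ratio of two coefficients has its q^n-th power in k, so it is integral over k and lies in
  -- k.
  have hs : ∀ j, ∃ s : k, r j = s • r i := by
    intro j
    have h1 : (↑u⁻¹ * r j) ^ q ^ n = algebraMap k A (m c j / m c i) := by
      have h2 : r j ^ q ^ n = algebraMap k A (m c j / m c i) * r i ^ q ^ n := by
        rw [hrpow, hrpow, ← Algebra.smul_def, smul_smul, div_mul_cancel₀ _ hmi]
      rw [mul_pow, h2, ← hu, mul_left_comm, ← mul_pow, Units.inv_mul, one_pow, mul_one]
    obtain ⟨s, hs⟩ := hA (↑u⁻¹ * r j)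
      (IsIntegral.of_pow (Nat.pos_of_ne_zero hQ) (h1 ▸ isIntegral_algebraMap))
    refine ⟨s, ?_⟩
    rw [Algebra.smul_def, hs, ← hu, mul_comm, Units.mul_inv_cancel_left]
  choose s hs using hs
  refine ⟨∑ i ∈ r.support, s i • β i, r i, (Algebra.TensorProduct.comm k K A).injective ?_⟩
  rw [← hy, Algebra.TensorProduct.comm_tmul, TensorProduct.tmul_sum]
  conv_lhs => rw [hsum]
  refine Finset.sum_congr rfl fun j _ => ?_
  conv_lhs => rw [hs]
  rw [TensorProduct.smul_tmul]

/-! ### Descent from the algebraic closure -/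

section Descent

variable {k L K A : Type*} [Field k] [Field L] [Algebra k L] [Field K] [Algebra k K]

theorem linearIndependent_fractionRing_tensor {ι : Type*} {v : ι → K}
    (hv : LinearIndependent k v) :
    LinearIndependent L
      fun i => algebraMap (L ⊗[k] K) (FractionRing (L ⊗[k] K)) (1 ⊗ₜ v i) :=
  (Module.Flat.linearIndependent_one_tmul (S := L) hv).map'
    (IsScalarTower.toAlgHom L (L ⊗[k] K) (FractionRing (L ⊗[k] K))).toLinearMap
    (LinearMap.ker_eq_bot.2 (IsFractionRing.injective _ _))

/-- This is K ∩ L = k inside Frac(L ⊗ K): if s ∉ k, then 1 and s are independent over k and remain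
so over L. -/
theorem mem_range_of_algebraMap_eq {s : K} {l : L}
    (h : algebraMap (L ⊗[k] K) (FractionRing (L ⊗[k] K)) (1 ⊗ₜ s) = algebraMap L _ l) :
    s ∈ (algebraMap k K).range := by
  by_contra hs
  have hv : LinearIndependent k ![1, s] := by
    rw [LinearIndependent.pair_iff]
    intro a b hab
    have hb : b = 0 := by
      by_contra hb
      refine hs ⟨-(b⁻¹ * a), ?_⟩
      rw [Algebra.algebraMap_eq_smul_one, neg_smul, mul_smul, eq_neg_of_add_eq_zero_left hab,
        smul_neg, neg_neg, inv_smul_smul₀ hb]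
    subst hb
    simpa using hab
  have h1 := linearIndependent_fractionRing_tensor (L := L) hv
  have h2 := Fintype.linearIndependent_iff.1 h1 ![l, -1] (by
    simp [Fin.sum_univ_two, h, ← Algebra.TensorProduct.one_def, Algebra.smul_def]) 1
  simp at h2

variable [IsDomain (L ⊗[k] K)]

/-- MacLane's criterion: taking q^n-th roots in L of the coefficients turns a relation into a q^n-th
power in the reduced ring L ⊗ K. -/
theorem linearIndependent_pow_expChar_pow [IsAlgClosed L] (q n : ℕ) [ExpChar k q]
    {ι : Type*} {v : ι → K} (hv : LinearIndependent k v) :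
    LinearIndependent k fun i => v i ^ q ^ n := by
  have : ExpChar (L ⊗[k] K) q :=
    expChar_of_injective_algebraMap (algebraMap k (L ⊗[k] K)).injective q
  have : ExpChar L q := expChar_of_injective_algebraMap (algebraMap k L).injective q
  have hQ : 0 < q ^ n := pow_pos (expChar_pos k q) _
  rw [linearIndependent_iff']
  intro s g hg i hi
  have hroot : ∀ j, ∃ l : L, l ^ q ^ n = algebraMap k L (g j) :=
    fun j => IsAlgClosed.exists_pow_nat_eq _ hQ
  choose l hl using hroot
  have h0 : ∑ j ∈ s, l j • ((1 : L) ⊗ₜ[k] v j) = 0 := by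
    refine eq_zero_of_pow_eq_zero (n := q ^ n) ?_
    rw [sum_pow_char_pow q]
    calc _ = ∑ j ∈ s, (1 : L) ⊗ₜ[k] (g j • v j ^ q ^ n) := Finset.sum_congr rfl fun j _ => by
          rw [smul_pow, hl, algebraMap_smul, Algebra.TensorProduct.tmul_pow, one_pow,
            TensorProduct.tmul_smul]
      _ = 0 := by rw [← TensorProduct.tmul_sum, hg, TensorProduct.tmul_zero]
  have := (linearIndependent_iff'.1 (Module.Flat.linearIndependent_one_tmul (S := L) hv)) s l h0 i hi
  have h1 := hl i
  rwa [this, zero_pow hQ.ne', eq_comm, FaithfulSMul.algebraMap_eq_zero_iff] at h1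

variable [CommRing A] [Algebra k A]

/-- Ratios of the coefficients lie in both K and L, hence in k. -/
theorem exists_eq_tmul_of_forall_repr_eq_mul {ι : Type*} (d : Module.Basis ι k A) {z : K ⊗[k] A}
    (c : FractionRing (L ⊗[k] K)) (l : ι → L)
    (h : ∀ i, algebraMap (L ⊗[k] K) (FractionRing (L ⊗[k] K))
      (1 ⊗ₜ (d.baseChange K).repr z i) = c * algebraMap L _ (l i)) :
    ∃ (c' : K) (a : A), z = c' ⊗ₜ a := by
  set b := (d.baseChange K).repr z with hb
  have hsum : z = ∑ i ∈ b.support, b i ⊗ₜ d i := by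
    conv_lhs => rw [← (d.baseChange K).linearCombination_repr z]
    rw [Finsupp.linearCombination_apply, Finsupp.sum]
    refine Finset.sum_congr rfl fun i _ => ?_
    rw [Module.Basis.baseChange_apply, TensorProduct.smul_tmul', smul_eq_mul, mul_one]
  by_cases hz : ∀ i, b i = 0
  · refine ⟨0, 0, ?_⟩
    rw [hsum, TensorProduct.tmul_zero]
    exact Finset.sum_eq_zero fun i _ => by rw [hz, TensorProduct.zero_tmul]
  push Not at hz
  obtain ⟨i, hi⟩ := hz
  let f : K →+* FractionRing (L ⊗[k] K) := (algebraMap (L ⊗[k] K) _).comp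
    (Algebra.TensorProduct.includeRight : K →ₐ[k] L ⊗[k] K).toRingHom
  have hf : ∀ j, f (b j) = c * algebraMap L _ (l j) := h
  have hcl : c * algebraMap L _ (l i) ≠ 0 := by
    rw [← hf]
    simpa using hi
  have hs : ∀ j, ∃ s : k, b j = s • b i := by
    intro j
    obtain ⟨s, hs⟩ := mem_range_of_algebraMap_eq (k := k) (s := b j / b i) (l := l j / l i) (by
      change f (b j / b i) = _
      rw [map_div₀, map_div₀, hf, hf, mul_div_mul_left _ _ (left_ne_zero_of_mul hcl)])
    refine ⟨s, ?_⟩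
    rw [Algebra.smul_def, hs, div_mul_cancel₀ _ hi]
  choose s hs using hs
  refine ⟨b i, ∑ j ∈ b.support, s j • d j, ?_⟩
  conv_lhs => rw [hsum]
  rw [TensorProduct.tmul_sum]
  refine Finset.sum_congr rfl fun j _ => ?_
  conv_lhs => rw [hs]
  rw [TensorProduct.smul_tmul]

end Descent

/-! ### Units of K ⊗ A -/

/-- For q = 1 the power is trivial, and the point is that L ⊗ A is reduced; for q = p any nilpotency
exponent m is below p^m. -/
theorem exists_pow_eq_zero_of_mem_map_nilradical {k L A K : Type*} [Field k] [Field L]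
    [Algebra k L] [Algebra.IsAlgebraic k L] [CommRing A] [Nontrivial A] [Algebra k A]
    (q : ℕ) [hq : ExpChar k q] (hA : ∀ a : A, IsIntegral k a → a ∈ (algebraMap k A).range)
    [Field K] [Algebra L K] {z : K ⊗[L] (L ⊗[k] A)}
    (hz : z ∈ (nilradical (L ⊗[k] A)).map
      (Algebra.TensorProduct.includeRight : (L ⊗[k] A) →ₐ[L] K ⊗[L] (L ⊗[k] A))) :
    ∃ n : ℕ, z ^ q ^ n = 0 := by
  cases hq with
  | zero =>
    have : nilradical (L ⊗[k] A) = ⊥ := by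
      rw [eq_bot_iff]
      intro x hx
      obtain ⟨n, hn⟩ := exists_pow_eq_zero_of_isNilpotent 1 hA (mem_nilradical.1 hx)
      simpa using hn
    rw [this, Ideal.map_bot, Ideal.mem_bot] at hz
    exact ⟨0, by simp [hz]⟩
  | prime hp =>
    have hle : (nilradical (L ⊗[k] A)).map
        (Algebra.TensorProduct.includeRight : (L ⊗[k] A) →ₐ[L] K ⊗[L] (L ⊗[k] A)) ≤
        nilradical _ := by
      rw [Ideal.map_le_iff_le_comap]
      intro x hx
      exact mem_nilradical.2 ((mem_nilradical.1 hx).map _)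
    obtain ⟨m, hm⟩ := mem_nilradical.1 (hle hz)
    exact ⟨m, pow_eq_zero_of_le (Nat.lt_pow_self hp.one_lt).le hm⟩

theorem nontrivial_tensorProduct_baseChange {k L A K : Type*} [Field k] [Field L] [Algebra k L]
    [CommRing A] [Nontrivial A] [Algebra k A] [Field K] [Algebra L K] :
    Nontrivial (K ⊗[L] (L ⊗[k] A)) :=
  inferInstance

theorem repr_cancelBaseChange_tmul {k L A K ι : Type*} [Field k] [Field L]
    [Algebra k L] [CommRing A] [Algebra k A] [Field K] [Algebra k K] [Algebra L K]
    [IsScalarTower k L K] (d : Module.Basis ι k A) (c : K) (w : L ⊗[k] A) (i : ι) :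
    (d.baseChange K).repr (Algebra.TensorProduct.cancelBaseChange k L L K A (c ⊗ₜ w)) i =
      c * algebraMap L K ((d.baseChange L).repr w i) := by
  induction w with
  | zero => simp
  | add x y hx hy => simp [TensorProduct.tmul_add, hx, hy, mul_add]
  | tmul s y =>
    rw [Algebra.TensorProduct.cancelBaseChange_tmul]
    simp [Algebra.smul_def, IsScalarTower.algebraMap_apply k L K]
    ring

/-- Let `K / k` be a regular extension, as witnessed by an algebraic closure `L` of `k`, and let
`k` be algebraically closed in a reduced `k`-algebra `A` of finite type. Then units of `K ⊗ A` are
pure tensors. -/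
theorem exists_eq_tmul_of_isUnit_of_finiteType {k K A : Type*} (L : Type*) [Field k] [Field L]
    [Algebra k L] [Algebra.IsAlgebraic k L] [IsAlgClosed L] [Field K] [Algebra k K]
    [IsDomain (L ⊗[k] K)] [CommRing A] [IsReduced A] [Nontrivial A] [Algebra k A]
    [Algebra.FiniteType k A]
    (hA : ∀ a : A, IsIntegral k a → a ∈ (algebraMap k A).range) {x : K ⊗[k] A} (hx : IsUnit x) :
    ∃ (c : K) (a : A), x = c ⊗ₜ a := by
  obtain ⟨q, hq⟩ := ExpChar.exists k
  let K' := FractionRing (L ⊗[k] K)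
  let f : K →ₐ[k] K' := (IsScalarTower.toAlgHom k (L ⊗[k] K) K').comp
    Algebra.TensorProduct.includeRight
  let e := Algebra.TensorProduct.cancelBaseChange k L L K' A
  let F := Algebra.TensorProduct.map f (AlgHom.id k A)
  have hX : IsUnit (e.symm (F x)) := (hx.map F).map e.symm
  obtain ⟨c, w, hcw⟩ := exists_sub_tmul_mem_map_nilradical
    (fun _ he => eq_zero_or_eq_one_of_isIdempotentElem hA he) hX
  obtain ⟨n, hn⟩ := exists_pow_eq_zero_of_mem_map_nilradical q hA hcw
  have : Nontrivial (K' ⊗[L] (L ⊗[k] A)) := nontrivial_tensorProduct_baseChange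
  have : ExpChar (K' ⊗[L] (L ⊗[k] A)) q :=
    have : ExpChar L q := expChar_of_injective_algebraMap (algebraMap k L).injective q
    expChar_of_injective_algebraMap (algebraMap L (K' ⊗[L] (L ⊗[k] A))).injective q
  rw [sub_pow_expChar_pow, sub_eq_zero, ← map_pow, ← map_pow, Algebra.TensorProduct.tmul_pow,
    AlgEquiv.symm_apply_eq] at hn
  let d := Module.Basis.ofVectorSpace k A
  -- Over K' the power x^(q^n) equals c^(q^n) ⊗ w^(q^n), so its coefficients are a common factor
  -- times elements of L.
  obtain ⟨ν, μ, hνμ⟩ := exists_eq_tmul_of_forall_repr_eq_mul d (z := x ^ q ^ n) (c ^ q ^ n)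
    (fun i => (d.baseChange L).repr (w ^ q ^ n) i) fun i => by
      rw [← repr_cancelBaseChange_tmul, ← hn, d.baseChange_repr_map]
      rfl
  let β := Module.Basis.ofVectorSpace k K
  exact exists_eq_tmul_of_pow_eq_tmul hA q n β
    (linearIndependent_pow_expChar_pow (L := L) q n β.linearIndependent)
    (isUnit_right_of_isUnit_tmul (hνμ ▸ hx.pow _)) hνμ hx.ne_zero

/-- x and its inverse are both defined over a finitely generated subalgebra of A, which inherits the
hypotheses. -/
theorem exists_eq_tmul_of_isUnit {k K A : Type*} (L : Type*) [Field k] [Field L]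
    [Algebra k L] [Algebra.IsAlgebraic k L] [IsAlgClosed L] [Field K] [Algebra k K]
    [IsDomain (L ⊗[k] K)] [CommRing A] [IsReduced A] [Nontrivial A] [Algebra k A]
    (hA : ∀ a : A, IsIntegral k a → a ∈ (algebraMap k A).range) {x : K ⊗[k] A} (hx : IsUnit x) :
    ∃ (c : K) (a : A), x = c ⊗ₜ a := by
  obtain ⟨y, hxy⟩ := hx.exists_right_inv
  obtain ⟨D₁, hD₁, hx₁⟩ := exists_fg_and_mem_baseChange x
  obtain ⟨D₂, hD₂, hy₂⟩ := exists_fg_and_mem_baseChange y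
  have mono : ∀ {D D' : Subalgebra k A}, D ≤ D' → D.baseChange K ≤ D'.baseChange K := by
    intro D D' h
    rintro _ ⟨z, rfl⟩
    refine ⟨Algebra.TensorProduct.map (AlgHom.id K K) (Subalgebra.inclusion h) z, ?_⟩
    induction z with
    | zero => simp
    | add x y hx hy => simp only [map_add, hx, hy]
    | tmul s y => simp
  have : Algebra.FiniteType k ↥(D₁ ⊔ D₂) := (Subalgebra.fg_iff_finiteType _).1 (hD₁.sup hD₂)
  obtain ⟨x', hx'⟩ := mono le_sup_left hx₁
  obtain ⟨y', hy'⟩ := mono le_sup_right hy₂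
  let F := Algebra.TensorProduct.map (AlgHom.id K K) (D₁ ⊔ D₂).val
  have hF : Function.Injective F :=
    Module.Flat.lTensor_preserves_injective_linearMap _ Subtype.val_injective
  have hxF : F x' = x := hx'
  have hyF : F y' = y := hy'
  have hu : IsUnit x' := IsUnit.of_mul_eq_one y' (hF (by rw [map_mul, map_one, hxF, hyF, hxy]))
  have : IsReduced ↥(D₁ ⊔ D₂) := isReduced_of_injective (D₁ ⊔ D₂).val Subtype.val_injective
  obtain ⟨c, a, hca⟩ := exists_eq_tmul_of_isUnit_of_finiteType L (fun a ha => by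
    obtain ⟨s, hs⟩ := hA a (ha.map (D₁ ⊔ D₂).val)
    exact ⟨s, Subtype.ext hs⟩) hu
  exact ⟨c, a, by rw [← hxF, hca]; simp [F]⟩

/-! ### From the field K to a subring B -/

theorem exists_equiv_tensorProduct_of_isPushout {k A B R : Type u} [CommRing k] [CommRing A]
    [CommRing B] [CommRing R] [Algebra k A] [Algebra k B] {i : A →+* R} {j : B →+* R}
    (h : IsPushout (CommRingCat.ofHom (algebraMap k A)) (CommRingCat.ofHom (algebraMap k B))
      (CommRingCat.ofHom i) (CommRingCat.ofHom j)) :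
    ∃ e : B ⊗[k] A ≃+* R, ∀ b a, e (b ⊗ₜ a) = j b * i a := by
  let := i.toAlgebra
  let := j.toAlgebra
  let := (i.comp (algebraMap k A)).toAlgebra
  have : IsScalarTower k A R := IsScalarTower.of_algebraMap_eq fun _ => rfl
  have : IsScalarTower k B R := IsScalarTower.of_algebraMap_eq fun x =>
    congrArg (fun f => f.hom x) h.w
  have hp : Algebra.IsPushout k B A R := (CommRingCat.isPushout_iff_isPushout).1 h.flip
  refine ⟨(Algebra.IsPushout.equiv k B A R).toRingEquiv, fun b a => ?_⟩
  exact Algebra.IsPushout.equiv_tmul k B A R b a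

/-- If an element of `B ⊗ A` lies in the subring `B'` of `B' ⊗ A` for some `B' ⊇ B`, then it
lies in `B`. -/
theorem exists_eq_tmul_one_of_map_eq {k A B B' : Type*} [Field k] [CommRing A] [Nontrivial A]
    [CommRing B] [CommRing B'] [Algebra k A] [Algebra k B] [Algebra k B'] (f : B →ₐ[k] B')
    (hf : Function.Injective f) {x : B ⊗[k] A} {b' : B'}
    (hx : Algebra.TensorProduct.map f (AlgHom.id k A) x = b' ⊗ₜ 1) :
    ∃ b, f b = b' ∧ x = b ⊗ₜ 1 := by
  obtain ⟨l, hl⟩ := exists_linearMap_apply_one k A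
  have hpr : ∀ z : B ⊗[k] A, TensorProduct.rid k B' (l.lTensor B'
      (Algebra.TensorProduct.map f (AlgHom.id k A) z)) =
        f (TensorProduct.rid k B (l.lTensor B z)) := by
    intro z
    induction z with
    | zero => simp
    | add x y hx hy => simp only [map_add, hx, hy]
    | tmul s y => simp
  have hb := hpr x
  rw [hx, LinearMap.lTensor_tmul, hl, TensorProduct.rid_tmul, one_smul] at hb
  refine ⟨_, hb.symm, Module.Flat.rTensor_preserves_injective_linearMap
    (M := A) f.toLinearMap hf ?_⟩
  exact hx.trans (by rw [hb]; simp)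

theorem exists_eq_of_isPushout_of_map_eq {k A B R B' R' : Type u} [Field k] [CommRing A]
    [Nontrivial A] [CommRing B] [CommRing R] [CommRing B'] [CommRing R'] {a : k →+* A}
    {b : k →+* B} {i : A →+* R} {j : B →+* R} {b' : k →+* B'} {i' : A →+* R'} {j' : B' →+* R'}
    (h : IsPushout (CommRingCat.ofHom a) (CommRingCat.ofHom b)
      (CommRingCat.ofHom i) (CommRingCat.ofHom j))
    (h' : IsPushout (CommRingCat.ofHom a) (CommRingCat.ofHom b')
      (CommRingCat.ofHom i') (CommRingCat.ofHom j'))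
    (f : B →+* B') (hf : Function.Injective f) (hfb : f.comp b = b') (ρ : R →+* R')
    (hi : ρ.comp i = i') (hj : ρ.comp j = j'.comp f) {x : R} {y : B'} (hx : ρ x = j' y) :
    ∃ z, x = j z := by
  let := a.toAlgebra
  let := b.toAlgebra
  let := b'.toAlgebra
  obtain ⟨e, he⟩ := exists_equiv_tensorProduct_of_isPushout h
  obtain ⟨e', he'⟩ := exists_equiv_tensorProduct_of_isPushout h'
  let F : B →ₐ[k] B' := { f with commutes' := fun s => congrArg (fun g => g s) hfb }
  have hρ : ∀ z, ρ (e z) = e' (Algebra.TensorProduct.map F (AlgHom.id k A) z) := by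
    intro z
    induction z with
    | zero => simp
    | add x y hx hy => simp only [map_add, hx, hy]
    | tmul s t =>
      rw [he, map_mul, Algebra.TensorProduct.map_tmul, he']
      exact congrArg₂ (· * ·) (congrArg (fun g => g s) hj) (congrArg (fun g => g t) hi)
  obtain ⟨z, rfl⟩ := e.surjective x
  obtain ⟨c, -, rfl⟩ := exists_eq_tmul_one_of_map_eq F hf (x := z) (b' := y)
    (e'.injective (by rw [← hρ, hx, he', map_one, mul_one]))
  exact ⟨c, by rw [he, map_one, mul_one]⟩

theorem injective_of_isPushout {k A B R : Type u} [Field k] [CommRing A]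
    [Nontrivial A] [CommRing B] [CommRing R] {a : k →+* A}
    {b : k →+* B} {i : A →+* R} {j : B →+* R}
    (h : IsPushout (CommRingCat.ofHom a) (CommRingCat.ofHom b)
      (CommRingCat.ofHom i) (CommRingCat.ofHom j)) : Function.Injective j := by
  let := a.toAlgebra
  let := b.toAlgebra
  obtain ⟨e, he⟩ := exists_equiv_tensorProduct_of_isPushout h
  have : Function.Injective (Algebra.TensorProduct.includeLeft : B →ₐ[k] B ⊗[k] A) :=
    Algebra.TensorProduct.includeLeft_injective (algebraMap k A).injective
  intro x y hxy
  refine this (e.injective ?_)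
  simpa [he] using hxy

theorem exists_eq_mul_of_isUnit_of_isPushout {k A B R K : Type u} [Field k] [CommRing A]
    [Nontrivial A] [IsReduced A] [CommRing B] [CommRing R] [Field K] {a : k →+* A}
    {b : k →+* B} {i : A →+* R} {j : B →+* R}
    (h : IsPushout (CommRingCat.ofHom a) (CommRingCat.ofHom b)
      (CommRingCat.ofHom i) (CommRingCat.ofHom j)) (ha : IsAlgebraicallyClosedIn a)
    (f : B →+* K) (hf : Function.Injective f) (hK : IsRegularExtension (f.comp b))
    {x : R} (hx : IsUnit x) : ∃ (s : Aˣ) (t : Bˣ), x = i s * j t := by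
  let := a.toAlgebra
  let := b.toAlgebra
  let := (f.comp b).toAlgebra
  have : IsDomain (AlgebraicClosure k ⊗[k] K) := hK
  have hA : ∀ z : A, IsIntegral k z → z ∈ (algebraMap k A).range :=
    fun z ⟨p, hp, hpz⟩ => ha z ⟨p, hp.ne_zero, hpz⟩
  obtain ⟨e, he⟩ := exists_equiv_tensorProduct_of_isPushout h
  let F : B →ₐ[k] K := { f with commutes' := fun s => rfl }
  let M := Algebra.TensorProduct.map F (AlgHom.id k A)
  have key : ∀ {y : B ⊗[k] A}, IsUnit y → ∃ (c : K) (u : Aˣ), M y = c ⊗ₜ ↑u := by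
    intro y hy
    obtain ⟨c, u, hcu⟩ := exists_eq_tmul_of_isUnit (AlgebraicClosure k) hA (hy.map M)
    obtain ⟨u, rfl⟩ := isUnit_right_of_isUnit_tmul (hcu ▸ hy.map M)
    exact ⟨c, u, hcu⟩
  obtain ⟨y, rfl⟩ := e.surjective x
  have hy : IsUnit y := by simpa using hx.map e.symm
  obtain ⟨c, u, hcu⟩ := key hy
  have hw : IsUnit (y * 1 ⊗ₜ ((u⁻¹ : Aˣ) : A)) := hy.mul
    ((u⁻¹.isUnit).map (Algebra.TensorProduct.includeRight : A →ₐ[k] B ⊗[k] A))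
  obtain ⟨w', hw'⟩ := hw.exists_right_inv
  have hMw : M (y * 1 ⊗ₜ ((u⁻¹ : Aˣ) : A)) = c ⊗ₜ 1 := by
    rw [map_mul, hcu]
    simp [M]
  obtain ⟨t, htc, ht⟩ := exists_eq_tmul_one_of_map_eq F hf hMw
  have hc0 : c ≠ 0 := by
    rintro rfl
    have := hw.map M
    rw [hMw, TensorProduct.zero_tmul] at this
    exact not_isUnit_zero this
  -- The inverse is treated in the same way, so that c is a unit of B and not merely an element.
  have hMw' : M w' = c⁻¹ ⊗ₜ 1 := by
    have h1 : c ⊗ₜ 1 * M w' = 1 := by rw [← hMw, ← map_mul, hw', map_one]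
    calc M w' = (c⁻¹ ⊗ₜ 1 * c ⊗ₜ 1) * M w' := by
          simp [inv_mul_cancel₀ hc0, ← Algebra.TensorProduct.one_def]
      _ = _ := by rw [mul_assoc, h1, mul_one]
  obtain ⟨t', htc', -⟩ := exists_eq_tmul_one_of_map_eq F hf hMw'
  have htt : t * t' = 1 := hf (by
    rw [map_mul, map_one]
    change F t * F t' = 1
    rw [htc, htc', mul_inv_cancel₀ hc0])
  refine ⟨u, Units.mkOfMulEqOne t t' htt, ?_⟩
  have hyt : y = t ⊗ₜ ↑u := by
    calc y = y * 1 ⊗ₜ ((u⁻¹ : Aˣ) : A) * 1 ⊗ₜ ↑u := by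
          simp [mul_assoc, ← Algebra.TensorProduct.one_def]
      _ = _ := by rw [ht]; simp
  rw [hyt, he, mul_comm]
  rfl

/-! ### Flat base change for sections of X × V -/

section Schemes

variable {k : Type u} [Field k] {X Y : Scheme.{u}}
    (f : X ⟶ Spec (CommRingCat.of k)) (g : Y ⟶ Spec (CommRingCat.of k))

/-- The structure map `k → Γ(Y, V)` of a `k`-scheme. -/
noncomputable def scalarsToOpen (V : Y.Opens) : k →+* Γ(Y, V) :=
  ((Scheme.ΓSpecIso (CommRingCat.of k)).inv ≫ g.appLE ⊤ V (by simp)).hom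

theorem map_comp_scalarsToOpen {V W : Y.Opens} (h : W ≤ V) :
    (Y.presheaf.map (homOfLE h).op).hom.comp (scalarsToOpen g V) = scalarsToOpen g W :=
  congrArg (fun φ => ((Scheme.ΓSpecIso (CommRingCat.of k)).inv ≫ φ).hom)
    (Scheme.Hom.appLE_map g (U := ⊤) (V := V) (by simp) (homOfLE h).op)

theorem scalarsToOpen_top : scalarsToOpen g ⊤ = scalarsToSections g := by
  simp [scalarsToOpen, scalarsToSections, Scheme.Hom.appTop, Scheme.Hom.app_eq_appLE]

/-- The pullback of sections over `V` along the second projection. -/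
noncomputable def sndSections (V : Y.Opens) :
    Γ(Y, V) →+* Γ(Limits.pullback f g, Limits.pullback.snd f g ⁻¹ᵁ V) :=
  ((Limits.pullback.snd f g).app V).hom

/-- The pullback of global sections along the first projection, restricted to the preimage of
`V`. -/
noncomputable def fstSections (V : Y.Opens) :
    Γ(X, ⊤) →+* Γ(Limits.pullback f g, Limits.pullback.snd f g ⁻¹ᵁ V) :=
  ((Limits.pullback.fst f g).appLE ⊤ (Limits.pullback.snd f g ⁻¹ᵁ V) (by simp)).hom

theorem isPushout_sections_of_isIso {V : Y.Opens}
    (h : IsIso (pushoutSection (IsPullback.of_hasPullback f g) (US := ⊤) (UX := ⊤) (UT := V)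
      (by simp) (by simp) (UY := Limits.pullback.snd f g ⁻¹ᵁ V) (by simp))) :
    IsPushout (CommRingCat.ofHom (scalarsToSections f)) (CommRingCat.ofHom (scalarsToOpen g V))
      (CommRingCat.ofHom (fstSections f g V)) (CommRingCat.ofHom (sndSections f g V)) := by
  have h1 := (isIso_pushoutSection_iff _ _ _ _).1 h
  refine h1.of_iso (Scheme.ΓSpecIso (CommRingCat.of k)) (Iso.refl _) (Iso.refl _) (Iso.refl _)
    ?_ ?_ ?_ ?_
  · simp [← scalarsToOpen_top, scalarsToOpen]
  · simp [scalarsToOpen]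
  · simp [fstSections]
  · simp [sndSections, Scheme.Hom.app_eq_appLE]

variable [CompactSpace X] [QuasiSeparatedSpace X]

theorem isPushout_sections_of_isAffineOpen {V : Y.Opens} (hV : IsAffineOpen V) :
    IsPushout (CommRingCat.ofHom (scalarsToSections f)) (CommRingCat.ofHom (scalarsToOpen g V))
      (CommRingCat.ofHom (fstSections f g V)) (CommRingCat.ofHom (sndSections f g V)) :=
  isPushout_sections_of_isIso f g <|
    isIso_pushoutSection_of_isQuasiSeparated_of_flat_right _ _ _ _ (isAffineOpen_top _) hV
      isCompact_univ ((isQuasiSeparated_univ_iff).2 inferInstance)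

theorem isPushout_sections_top [CompactSpace Y] [QuasiSeparatedSpace Y] :
    IsPushout (CommRingCat.ofHom (scalarsToSections f)) (CommRingCat.ofHom (scalarsToOpen g ⊤))
      (CommRingCat.ofHom (fstSections f g ⊤)) (CommRingCat.ofHom (sndSections f g ⊤)) := by
  refine isPushout_sections_of_isIso f g <|
    isIso_pushoutSection_of_isCompact_of_flat_right_of_ringHomFlat _ _ _ _ (isAffineOpen_top _)
      isCompact_univ ((isQuasiSeparated_univ_iff).2 inferInstance)
      isCompact_univ ((isQuasiSeparated_univ_iff).2 inferInstance) ?_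
  have h : f.appLE ⊤ ⊤ (by simp) = (Scheme.ΓSpecIso (CommRingCat.of k)).hom ≫
      CommRingCat.ofHom (scalarsToOpen f ⊤) := by simp [scalarsToOpen]
  rw [h, CommRingCat.hom_comp]
  refine RingHom.Flat.comp (RingHom.Flat.of_bijective ?_) ?_
  · exact (ConcreteCategory.bijective_of_isIso (Scheme.ΓSpecIso (CommRingCat.of k)).hom)
  · let := (scalarsToOpen f ⊤).toAlgebra
    exact (inferInstance : Module.Flat k Γ(X, ⊤))

end Schemes

/-! ### Gluing over an integral Y -/

section Gluing

variable {k : Type u} [Field k] {X Y : Scheme.{u}}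
    (f : X ⟶ Spec (CommRingCat.of k)) (g : Y ⟶ Spec (CommRingCat.of k))

/-- Restriction of sections of `X ×ₖ Y` between preimages of open subsets of `Y`. -/
noncomputable def resSections {V W : Y.Opens} (h : W ≤ V) :
    Γ(Limits.pullback f g, Limits.pullback.snd f g ⁻¹ᵁ V) →+*
      Γ(Limits.pullback f g, Limits.pullback.snd f g ⁻¹ᵁ W) :=
  ((Limits.pullback f g).presheaf.map
    (homOfLE ((Limits.pullback.snd f g).preimage_mono h)).op).hom

theorem resSections_comp_fstSections {V W : Y.Opens} (h : W ≤ V) :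
    (resSections f g h).comp (fstSections f g V) = fstSections f g W :=
  congrArg (fun φ => φ.hom) ((Limits.pullback.fst f g).appLE_map (U := ⊤)
    (V := Limits.pullback.snd f g ⁻¹ᵁ V) (by simp)
    (homOfLE ((Limits.pullback.snd f g).preimage_mono h)).op)

theorem resSections_comp_sndSections {V W : Y.Opens} (h : W ≤ V) :
    (resSections f g h).comp (sndSections f g V) =
      (sndSections f g W).comp (Y.presheaf.map (homOfLE h).op).hom :=
  congrArg (fun φ => φ.hom) ((Limits.pullback.snd f g).naturality (homOfLE h).op).symm

theorem resSections_sndSections {V W : Y.Opens} (h : W ≤ V) (y : Γ(Y, V)) :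
    resSections f g h (sndSections f g V y) =
      sndSections f g W ((Y.presheaf.map (homOfLE h).op).hom y) :=
  congrArg (fun φ => φ y) (resSections_comp_sndSections f g h)

theorem resSections_resSections {V W U : Y.Opens} (h : W ≤ V) (h' : U ≤ W)
    (x : Γ(Limits.pullback f g, Limits.pullback.snd f g ⁻¹ᵁ V)) :
    resSections f g h' (resSections f g h x) = resSections f g (h'.trans h) x := by
  simp only [resSections, ← CommRingCat.comp_apply, ← Functor.map_comp]
  rfl

variable [CompactSpace X] [QuasiSeparatedSpace X] [Nontrivial Γ(X, ⊤)]

theorem sndSections_injective [AlgebraicGeometry.IsIntegral Y] {V : Y.Opens}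
    (hV : genericPoint Y ∈ V) : Function.Injective (sndSections f g V) := by
  obtain ⟨W, hW, hηW, hWV⟩ := exists_isAffineOpen_mem_and_subset hV
  have : Nonempty W := ⟨_, hηW⟩
  intro y z hyz
  apply map_injective_of_isIntegral Y (homOfLE hWV)
  apply injective_of_isPushout (isPushout_sections_of_isAffineOpen f g hW)
  exact (resSections_sndSections f g hWV y).symm.trans
    ((congrArg _ hyz).trans (resSections_sndSections f g hWV z))

/-- Every nonempty open contains the generic point, so each affine open can be compared with V₀ on a
smaller affine one. There the coefficient already lies in the smaller ring, and injectivity of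
pullback makes the local functions agree. -/
theorem exists_eq_sndSections [AlgebraicGeometry.IsIntegral Y] {V₀ : Y.Opens}
    (hV₀ : genericPoint Y ∈ V₀)
    {β : Γ(Limits.pullback f g, Limits.pullback.snd f g ⁻¹ᵁ ⊤)} {y₀ : Γ(Y, V₀)}
    (hβ : resSections f g le_top β = sndSections f g V₀ y₀) :
    ∃ y, β = sndSections f g ⊤ y := by
  let ι := {V : Y.Opens // IsAffineOpen V ∧ genericPoint Y ∈ V}
  have hloc : ∀ V : ι, ∃ y : Γ(Y, V.1), resSections f g le_top β = sndSections f g V.1 y := by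
    rintro ⟨V, hV, hηV⟩
    obtain ⟨W, hW, hηW, hWV⟩ := exists_isAffineOpen_mem_and_subset
      (show genericPoint Y ∈ V ⊓ V₀ from ⟨hηV, hV₀⟩)
    have : Nonempty W := ⟨_, hηW⟩
    have hWV' : W ≤ V := hWV.trans inf_le_left
    have hWV₀ : W ≤ V₀ := hWV.trans inf_le_right
    refine exists_eq_of_isPushout_of_map_eq (isPushout_sections_of_isAffineOpen f g hV)
      (isPushout_sections_of_isAffineOpen f g hW) _ (map_injective_of_isIntegral Y (homOfLE hWV'))
      (map_comp_scalarsToOpen g hWV') (resSections f g hWV')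
      (resSections_comp_fstSections f g hWV') (resSections_comp_sndSections f g hWV')
      (y := (Y.presheaf.map (homOfLE hWV₀).op).hom y₀) ?_
    rw [resSections_resSections, ← resSections_sndSections, ← hβ, resSections_resSections]
  choose y hy using hloc
  have hcov : (⊤ : Y.Opens) ≤ iSup fun V : ι => V.1 := by
    intro p _
    obtain ⟨V, hV, hpV, -⟩ := exists_isAffineOpen_mem_and_subset (show p ∈ (⊤ : Y.Opens) from trivial)
    exact TopologicalSpace.Opens.mem_iSup.2 ⟨⟨V, hV,
      ((genericPoint_spec Y).mem_open_set_iff V.2).2 ⟨p, trivial, hpV⟩⟩, hpV⟩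
  obtain ⟨z, hz, -⟩ := Y.sheaf.existsUnique_gluing' (fun V : ι => V.1) ⊤
    (fun V => homOfLE le_top) hcov y (by
      intro V W
      apply sndSections_injective f g (V := V.1 ⊓ W.1) ⟨V.2.2, W.2.2⟩
      refine (resSections_sndSections f g inf_le_left (y V)).symm.trans
        (Eq.trans ?_ (resSections_sndSections f g inf_le_right (y W)))
      rw [← hy, ← hy, resSections_resSections, resSections_resSections])
  refine ⟨z, ?_⟩
  refine (Limits.pullback f g).sheaf.eq_of_locally_eq'
    (fun V : ι => Limits.pullback.snd f g ⁻¹ᵁ V.1) (Limits.pullback.snd f g ⁻¹ᵁ ⊤)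
    (fun V => homOfLE ((Limits.pullback.snd f g).preimage_mono le_top)) ?_ _ _ ?_
  · rw [← Scheme.Hom.preimage_iSup]
    exact (Limits.pullback.snd f g).preimage_mono hcov
  · intro V
    refine (hy V).trans (Eq.trans ?_ (resSections_sndSections f g le_top z).symm)
    exact congrArg _ (hz V).symm

theorem exists_units_of_isIntegral [_root_.IsReduced Γ(X, ⊤)] [AlgebraicGeometry.IsIntegral Y]
    (hX : IsAlgebraicallyClosedIn (scalarsToSections f))
    (hY : IsRegularExtension (scalarsToFunctionField g))
    {α : Γ(Limits.pullback f g, Limits.pullback.snd f g ⁻¹ᵁ ⊤)} (hα : IsUnit α) :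
    ∃ (μ : Γ(X, ⊤)ˣ) (ν : Γ(Y, ⊤)ˣ), α = fstSections f g ⊤ μ * sndSections f g ⊤ ν := by
  obtain ⟨V, hV, hηV, -⟩ :=
    exists_isAffineOpen_mem_and_subset (show genericPoint Y ∈ (⊤ : Y.Opens) from trivial)
  have hreg : (Y.presheaf.germ V (genericPoint Y) hηV).hom.comp (scalarsToOpen g V) =
      scalarsToFunctionField g := by
    rw [scalarsToFunctionField, ← scalarsToOpen_top, ← map_comp_scalarsToOpen g (le_top : V ≤ ⊤),
      ← RingHom.comp_assoc, ← CommRingCat.hom_comp, Y.presheaf.germ_res]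
  obtain ⟨μ, t, hμt⟩ := exists_eq_mul_of_isUnit_of_isPushout
    (isPushout_sections_of_isAffineOpen f g hV) hX (Y.presheaf.germ V (genericPoint Y) hηV).hom
    (germ_injective_of_isIntegral Y _ hηV) (hreg ▸ hY) (hα.map (resSections f g le_top))
  have hfst : ∀ s, resSections f g (le_top : V ≤ ⊤) (fstSections f g ⊤ s) = fstSections f g V s :=
    fun s => RingHom.congr_fun (resSections_comp_fstSections f g le_top) s
  obtain ⟨a, rfl⟩ := hα
  let m := Units.map (fstSections f g ⊤).toMonoidHom μ
  let β := m⁻¹ * a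
  have hβ : Units.map (resSections f g (le_top : V ≤ ⊤)).toMonoidHom β =
      Units.map (sndSections f g V).toMonoidHom t := by
    rw [map_mul, map_inv, inv_mul_eq_iff_eq_mul]
    ext
    exact hμt.trans (congrArg (· * _) (hfst μ).symm)
  obtain ⟨y, hy⟩ := exists_eq_sndSections f g hηV (congrArg Units.val hβ)
  -- Extending β⁻¹ as well makes the extended function a unit.
  obtain ⟨z, hz⟩ := exists_eq_sndSections f g hηV (β := ((β⁻¹ : _ˣ) : _)) (y₀ := ((t⁻¹ : _ˣ) : _))
    (congrArg Units.val (congrArg (·⁻¹) hβ))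
  have hyz : y * z = 1 := sndSections_injective f g (V := ⊤) trivial (by
    rw [map_mul, map_one, ← hy, ← hz, Units.mul_inv])
  refine ⟨μ, Units.mkOfMulEqOne y z hyz, ?_⟩
  change (a : Γ(Limits.pullback f g, Limits.pullback.snd f g ⁻¹ᵁ ⊤)) = m * sndSections f g ⊤ y
  rw [← hy, ← Units.val_mul, mul_inv_cancel_left]

end Gluing

theorem mainTheorem11 {k : Type u} [Field k] {X Y : Scheme.{u}}
    (f : X ⟶ Spec (CommRingCat.of k)) (g : Y ⟶ Spec (CommRingCat.of k))
    [CompactSpace X] [QuasiSeparatedSpace X]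
    (hXred : _root_.IsReduced Γ(X, ⊤))
    (hXclosed : IsAlgebraicallyClosedIn (scalarsToSections f))
    (hY :
      (∃ _ : AlgebraicGeometry.IsIntegral Y, IsRegularExtension (scalarsToFunctionField g)) ∨
      (CompactSpace Y ∧ QuasiSeparatedSpace Y ∧ ∃ _ : IsDomain Γ(Y, ⊤),
        IsRegularExtension
          ((algebraMap Γ(Y, ⊤) (FractionRing Γ(Y, ⊤))).comp (scalarsToSections g))))
    (α : Γ(Limits.pullback f g, ⊤)ˣ) :
    ∃ (μ : Γ(X, ⊤)ˣ) (ν : Γ(Y, ⊤)ˣ),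
      (α : Γ(Limits.pullback f g, ⊤)) =
        (Limits.pullback.fst f g).appTop.hom (μ : Γ(X, ⊤)) *
          (Limits.pullback.snd f g).appTop.hom (ν : Γ(Y, ⊤)) := by
  -- If k[X] = 0, the sections of the product also form the zero ring.
  rcases subsingleton_or_nontrivial Γ(X, ⊤) with hX | hX
  · have := (Limits.pullback.fst f g).appTop.hom.codomain_trivial
    exact ⟨1, 1, Subsingleton.elim _ _⟩
  have hα : IsUnit (show Γ(Limits.pullback f g, Limits.pullback.snd f g ⁻¹ᵁ ⊤) from α.val) :=
    α.isUnit
  obtain ⟨μ, ν, h⟩ : ∃ (μ : Γ(X, ⊤)ˣ) (ν : Γ(Y, ⊤)ˣ),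
      (show Γ(Limits.pullback f g, Limits.pullback.snd f g ⁻¹ᵁ ⊤) from α.val) =
        fstSections f g ⊤ μ * sndSections f g ⊤ ν := by
    rcases hY with ⟨hY, hK⟩ | ⟨hY, hY', hB, hK⟩
    · exact exists_units_of_isIntegral f g hXclosed hK hα
    · rw [← scalarsToOpen_top] at hK
      exact exists_eq_mul_of_isUnit_of_isPushout (isPushout_sections_top f g) hXclosed
        (algebraMap Γ(Y, ⊤) (FractionRing Γ(Y, ⊤))) (IsFractionRing.injective _ _) hK hα
  refine ⟨μ, ν, h.trans ?_⟩
  rw [fstSections, sndSections]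
  congr 2
  exact congrArg CommRingCat.Hom.hom (Scheme.Hom.appLE_eq_app _)
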